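/- **Proposition (convergence of the generalized Levenberg–Marquardt projected-Newton method).** Let $C\subset\mathbb{R}^N$ be closed and nonempty, let $h:\mathbb{R}^N\to\mathbb{R}$ be differentiable with $L$-Lipschitz gradient ($L\ge 0$), and let $f:=h+\delta_C$, where $\delta_C$ equals $0$ on $C$ and $+\infty$ elsewhere. *Subdifferential.* For $f:\mathbb{R}^N\to\mathbb{R}\cup\{+\infty\}$ and $x\in\operatorname{dom}f=\{f<+\infty\}$, $\partial_F f(x)$ is the set of $p$ with $\liminf_{y\to x,\,y\ne x}\frac{f(y)-f(x)-\langle p,y-x\rangle}{\|y-x\|}\ge 0$, and $\partial f(x)$ is the set of limits of sequences $p^k\in\partial_F f(u^k)$ with $u^k\to x$ and $f(u^k)\to f(x)$; both sets are empty for $x\notin\operatorname{dom}f$. A point $x$ is critical if $0\in\partial f(x)$. Put $\|\partial f(x)\|_-:=\inf_{p\in\partial f(x)}\|p\|$ ($+\infty$ if $\partial f(x)=\emptyset$). *KŁ function.* $f$ is a KŁ function if it is proper and lower semicontinuous and, for every $x^*$ with $\partial f(x^*)\neq\emptyset$, there are $\delta>0$, $\eta\in(0,+\infty]$ and a continuous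 concave $\varphi:[0,\eta)\to[0,+\infty)$ with $\varphi(0)=0$, continuously differentiable on $(0,\eta)$ with $\varphi'>0$, such that $\varphi'(f(x)-f(x^*))\,\|\partial f(x)\|_-\ge 1$ whenever $\|x-x^*\|<\delta$ and $f(x^*)<f(x)<f(x^*)+\eta$. *Generalized Levenberg–Marquardt metric.* Let $$\partial^2h(x):=\operatorname{co}\Big\{\lim_{n\to\infty}\nabla^2h(x_n)\;:\;\nabla h\text{ differentiable at each }x_n,\ x_n\to x\Big\}$$ be Clarke's generalized Hessian. Let $\varepsilon>0$. For a given $x^k$, choose $H_k\in\partial^2h(x^k)$, let $P_k$ be the projection of $H_k$, for the Frobenius norm, onto the cone of symmetric positive semidefinite $N\times N$ matrices, and set $A_k:=P_k+\varepsilon I_N$. Write $\|v\|_{A}:=\sqrt{\langle Av,v\rangle}$, and let $\operatorname{proj}_C^{A}(z)$ be the set of minimizers of $\|y-z\|_{A}$ over $y\in C$. *Statement.* Assume that $f$ is a KŁ function. Let $x^0\in\mathbb{R}^N$ and let $(x^k)$ be a bounded sequence with $$x^{k+1}\in\operatorname{proj}_C^{A_k}\big(x^k-\lambda_kA_k^{-1}\nabla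 h(x^k)\big)\qquad(k\in\mathbb{N}),$$ where each $A_k$ is chosen as above from $x^k$, and where the step sizes satisfy, for some $\bar\lambda\in\mathbb{R}$, $$0<\lambda_k\le\bar\lambda,\quad \bar\lambda L<\varepsilon,\quad \sum_k\lambda_k=+\infty,\quad \sup_{k}\frac{\lambda_{k+1}}{\lambda_k}<+\infty .$$ Then $\sum_{k}\|x^{k+1}-x^k\|<+\infty$, and $(x^k)$ converges to a critical point of $f$. -/

import Mathlib

open Filter Topology

noncomputable section

namespace GLM

/-! ### Extended-real-valued functions, subdifferentials, critical points -/

section Subdifferential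

variable {E : Type*} [NormedAddCommGroup E] [InnerProductSpace ℝ E]

/-- The domain `{x | f x < +∞}`. -/
def dom (f : E → EReal) : Set E := {x | f x < ⊤}

/-- A function with values in `ℝ ∪ {+∞}` that is not identically `+∞`. -/
def IsProper (f : E → EReal) : Prop := (∀ x, f x ≠ ⊥) ∧ (dom f).Nonempty

/-- The Fréchet subdifferential:
`liminf_{y → x, y ≠ x} (f y - f x - ⟪p, y - x⟫) / ‖y - x‖ ≥ 0`, and empty off the domain. -/
def frechetSubdifferential (f : E → EReal) (x : E) : Set E :=
  {p | x ∈ dom f ∧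
    0 ≤ liminf (fun y : E =>
      (f y - f x - ((inner ℝ p (y - x) : ℝ) : EReal)) / ((‖y - x‖ : ℝ) : EReal)) (𝓝[≠] x)}

/-- The limiting (Fréchet) subdifferential: weak limits of Fréchet subgradients `p k` at points
`u k` with `u k → x` and `f (u k) → f x`; empty off the domain. -/
def limitingSubdifferential (f : E → EReal) (x : E) : Set E :=
  {p | x ∈ dom f ∧ ∃ (u : ℕ → E) (q : ℕ → E),
    Tendsto u atTop (𝓝 x) ∧ Tendsto (fun k => f (u k)) atTop (𝓝 (f x)) ∧
    (∀ v : E, Tendsto (fun k => (inner ℝ (q k) v : ℝ)) atTop (𝓝 (inner ℝ p v))) ∧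
    ∀ k, q k ∈ frechetSubdifferential f (u k)}

/-- `x` is a critical point of `f` when `0` is a limiting subgradient of `f` at `x`. -/
def IsCriticalPoint (f : E → EReal) (x : E) : Prop := (0 : E) ∈ limitingSubdifferential f x

/-- The lazy slope `inf {‖p‖ | p ∈ ∂f x}`, equal to `+∞` when `∂f x` is empty. -/
def lazySlope (f : E → EReal) (x : E) : ENNReal :=
  ⨅ p ∈ limitingSubdifferential f x, ENNReal.ofReal ‖p‖

/-! ### The Kurdyka-Łojasiewicz property -/

/-- `φ : [0, η) → [0, ∞)` is continuous and concave, `φ 0 = 0`, and `φ` is continuously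
differentiable on `(0, η)` with positive derivative; here `0 < η ≤ +∞`. -/
structure IsDesingularizing (η : EReal) (φ : ℝ → ℝ) : Prop where
  pos : 0 < η
  nonneg : ∀ t : ℝ, 0 ≤ t → (t : EReal) < η → 0 ≤ φ t
  continuousOn : ContinuousOn φ {t : ℝ | 0 ≤ t ∧ (t : EReal) < η}
  concaveOn : ConcaveOn ℝ {t : ℝ | 0 ≤ t ∧ (t : EReal) < η} φ
  map_zero : φ 0 = 0
  contDiffOn : ContDiffOn ℝ 1 φ {t : ℝ | 0 < t ∧ (t : EReal) < η}
  deriv_pos : ∀ t : ℝ, 0 < t → (t : EReal) < η → 0 < deriv φ t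

/-- The strict local upper level set
`{x | ‖x - x₀‖ < δ and f x₀ < f x < f x₀ + η}`. -/
def strictUpperLevel (f : E → EReal) (η : EReal) (x₀ : E) (δ : ℝ) : Set E :=
  {x | ‖x - x₀‖ < δ ∧ f x₀ < f x ∧ f x < f x₀ + η}

/-- The Kurdyka-Łojasiewicz inequality `φ' (f x - f x₀) * ‖∂f x‖₋ ≥ 1` near `x₀`, for some
desingularizing function `φ`. -/
def HasKLPropertyAt (f : E → EReal) (x₀ : E) : Prop :=
  ∃ (η : EReal) (φ : ℝ → ℝ) (δ : ℝ), IsDesingularizing η φ ∧ 0 < δ ∧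
    ∀ x ∈ strictUpperLevel f η x₀ δ,
      1 ≤ ENNReal.ofReal (deriv φ (f x - f x₀).toReal) * lazySlope f x

/-- A proper lower semicontinuous function with the Kurdyka-Łojasiewicz property at each point
where its limiting subdifferential is non-empty. -/
structure IsKLFunction (f : E → EReal) : Prop where
  proper : IsProper f
  lowerSemicontinuous : LowerSemicontinuous f
  kl : ∀ x, (limitingSubdifferential f x).Nonempty → HasKLPropertyAt f x

open Classical in
/-- The function `δ_C`: `0` on `C` and `+∞` off `C`. -/
def indicatorFun (C : Set E) (x : E) : EReal := if x ∈ C then 0 else ⊤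

/-- The function `h + δ_C`. -/
def constrained (h : E → ℝ) (C : Set E) (x : E) : EReal := (h x : EReal) + indicatorFun C x

end Subdifferential

/-! ### Metric projections and the generalized Levenberg-Marquardt choice of metric -/

section LevenbergMarquardt

variable {N : ℕ}

/-- The norm `‖v‖_A = √⟪A v, v⟫` on `ℝ^N` (used with `A` positive definite). -/
def metricNorm (A : Matrix (Fin N) (Fin N) ℝ) (v : EuclideanSpace ℝ (Fin N)) : ℝ :=
  Real.sqrt (inner ℝ (Matrix.toEuclideanCLM (𝕜 := ℝ) A v) v)

/-- The nearest points of `C` to `z` for the norm `‖·‖_A`. -/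
def metricProj (C : Set (EuclideanSpace ℝ (Fin N))) (A : Matrix (Fin N) (Fin N) ℝ)
    (z : EuclideanSpace ℝ (Fin N)) : Set (EuclideanSpace ℝ (Fin N)) :=
  {y | y ∈ C ∧ ∀ w ∈ C, metricNorm A (y - z) ≤ metricNorm A (w - z)}

/-- The matrix of the derivative of `∇h` at `x` (meaningful where `∇h` is differentiable). -/
def hessianMatrix (h : EuclideanSpace ℝ (Fin N) → ℝ) (x : EuclideanSpace ℝ (Fin N)) :
    Matrix (Fin N) (Fin N) ℝ :=
  Matrix.of fun i j => fderiv ℝ (gradient h) x (EuclideanSpace.single j (1 : ℝ)) i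

/-- The generalized Hessian, i.e. Clarke's generalized Jacobian of `∇h`: the convex hull of the
limits of `∇²h (u n)` along sequences `u n → x` of points where `∇h` is differentiable. -/
def clarkeHessian (h : EuclideanSpace ℝ (Fin N) → ℝ) (x : EuclideanSpace ℝ (Fin N)) :
    Set (Matrix (Fin N) (Fin N) ℝ) :=
  convexHull ℝ {M | ∃ u : ℕ → EuclideanSpace ℝ (Fin N), Tendsto u atTop (𝓝 x) ∧
    (∀ n, DifferentiableAt ℝ (gradient h) (u n)) ∧
    Tendsto (fun n => hessianMatrix h (u n)) atTop (𝓝 M)}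

/-- The Frobenius norm of a matrix. -/
def frobeniusNorm (M : Matrix (Fin N) (Fin N) ℝ) : ℝ := Real.sqrt (∑ i, ∑ j, M i j ^ 2)

/-- `P` is the projection of `M` onto the cone of symmetric positive semidefinite matrices, for
the Frobenius norm. -/
def IsPSDProjection (M P : Matrix (Fin N) (Fin N) ℝ) : Prop :=
  P.PosSemidef ∧ ∀ Q : Matrix (Fin N) (Fin N) ℝ, Q.PosSemidef →
    frobeniusNorm (M - P) ≤ frobeniusNorm (M - Q)

/-- `A` is obtained at `x` by the generalized Levenberg-Marquardt process: pick `M ∈ ∂²h x`,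
project it onto the positive semidefinite cone, and add `ε I`. -/
def IsLevenbergMarquardtMetric (h : EuclideanSpace ℝ (Fin N) → ℝ) (ε : ℝ)
    (x : EuclideanSpace ℝ (Fin N)) (A : Matrix (Fin N) (Fin N) ℝ) : Prop :=
  ∃ M ∈ clarkeHessian h x, ∃ P, IsPSDProjection M P ∧
    A = P + ε • (1 : Matrix (Fin N) (Fin N) ℝ)

end LevenbergMarquardt

end GLM

end

/-!
The iterates satisfy the two standard inequalities of descent methods. Write `d k` for
`‖x (k + 1) - x k‖` and `f = h + δ_C`. Since `C` may be non-convex, the minimizing property of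
`x (k + 1)` is used only as a comparison of quadratic functions (a variational inequality would not
be available):

* comparing `x (k + 1)` with `x k` (which lies in `C` as soon as `k ≥ 1`) and using the descent
  lemma gives `c * d k ^ 2 ≤ lam k * (f (x k) - f (x (k + 1)))` (`sufficient_decrease`), because
  `A k` is bounded below by `ε` and `lamBar * L < ε`;
* comparing `x (k + 1)` with an arbitrary point of `C` gives a quadratic upper bound for a linear
  form on `C`, that is, a Fréchet subgradient `p k` of `f` at `x (k + 1)` with
  `lam k * ‖p k‖ ≤ K * d k` (`exists_frechetSubgradient_norm_le`). The constant is uniform, because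
  Clarke's Hessian is bounded by the Lipschitz constant of the gradient and projecting onto the
  semidefinite cone at most doubles the Frobenius norm (`exists_norm_toEuclideanCLM_le`).

The convergence proof (`summable_and_exists_isCriticalPoint`) uses only these inequalities. Let `y`
be a cluster point, `r k = h (x k) - h y`, which decreases to `0`, and `φ` the desingularizing
function at `y`. Near `y`, the KL inequality and the concavity of `φ` turn the two inequalities into
`d k ^ 2 ≤ M * d (k - 1) * (φ (r k) - φ (r (k + 1)))`; the step sizes cancel, up to the bounded ratio
`lam k / lam (k - 1)`. By the inequality of the arithmetic and geometric means,
`d (k - 1) + M * φ (r k)` is then a Lyapunov function which decreases by at least `d k` at each step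
taken inside the ball. Starting close to `y` with a small value of this function, the sequence never
leaves the ball and has finite length (`summable_dist_of_local_lyapunov`). Finally `d` is summable
and `lam` is not, so `d k / lam k`, and with it `p k`, tends to `0` along a subsequence; hence the
limit is critical.
-/

namespace GLM

/-! ### The descent lemma -/

section Descent

variable {E : Type*} [NormedAddCommGroup E] [InnerProductSpace ℝ E] [CompleteSpace E]

/-- The descent lemma. -/
theorem le_add_inner_gradient_add_sq {h : E → ℝ} {L : NNReal} (hd : Differentiable ℝ h)
    (hL : LipschitzWith L (gradient h)) (x y : E) :
    h y ≤ h x + inner ℝ (gradient h x) (y - x) + L / 2 * ‖y - x‖ ^ 2 := by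
  set v := y - x with hv
  have hline : ∀ t : ℝ, HasDerivAt (fun s : ℝ => x + s • v) v t := fun t => by
    simpa using ((hasDerivAt_id t).smul_const v).const_add x
  have hder : ∀ t : ℝ, HasDerivAt
      (fun s : ℝ => h (x + s • v) - s * inner ℝ (gradient h x) v - L / 2 * ‖v‖ ^ 2 * s ^ 2)
      (inner ℝ (gradient h (x + t • v)) v - inner ℝ (gradient h x) v - L * ‖v‖ ^ 2 * t) t := by
    intro t
    have h1 := (hd (x + t • v)).hasGradientAt.hasFDerivAt.comp_hasDerivAt t (hline t)
    have h2 := (hasDerivAt_id t).mul_const (inner ℝ (gradient h x) v : ℝ)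
    have h3 := ((hasDerivAt_id t).pow 2).const_mul (L / 2 * ‖v‖ ^ 2)
    refine ((h1.sub h2).sub h3).congr_deriv ?_
    simp only [InnerProductSpace.toDual_apply_apply, id]
    ring
  have hanti := antitoneOn_of_deriv_nonpos (convex_Icc (0 : ℝ) 1)
    (fun t _ => (hder t).continuousAt.continuousWithinAt)
    (fun t _ => (hder t).differentiableAt.differentiableWithinAt)
    (fun t ht => by
      rw [interior_Icc] at ht
      rw [(hder t).deriv, ← inner_sub_left]
      have h1 := real_inner_le_norm (gradient h (x + t • v) - gradient h x) v
      have h2 := hL.norm_sub_le (x + t • v) x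
      rw [add_sub_cancel_left, norm_smul, Real.norm_of_nonneg ht.1.le] at h2
      nlinarith [mul_le_mul_of_nonneg_right h2 (norm_nonneg v)])
  have := hanti (Set.left_mem_Icc.2 zero_le_one) (Set.right_mem_Icc.2 zero_le_one) zero_le_one
  simp only [one_smul, zero_smul, add_zero, hv, add_sub_cancel] at this
  rw [hv]
  linarith

end Descent

/-! ### Subgradients of a smooth function restricted to a set -/

section Subgradients

variable {X E : Type*} [NormedAddCommGroup E] [InnerProductSpace ℝ E]

theorem constrained_of_mem {h : X → ℝ} {C : Set X} {x : X} (hx : x ∈ C) :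
    constrained h C x = (h x : EReal) := by
  simp [constrained, indicatorFun, hx]

theorem constrained_of_notMem {h : X → ℝ} {C : Set X} {x : X} (hx : x ∉ C) :
    constrained h C x = ⊤ := by
  simp [constrained, indicatorFun, hx]

/-- A vector `v` such that `⟪v, · - y⟫` is at most quadratic on `C` is a Fréchet normal to `C` at
`y`, so adding it to the gradient of `h` gives a Fréchet subgradient of `h + δ_C`. -/
theorem gradient_add_mem_frechetSubdifferential [CompleteSpace E] {h : E → ℝ} {C : Set E}
    {y v : E} (hd : DifferentiableAt ℝ h y) (hy : y ∈ C) (c : ℝ)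
    (hv : ∀ w ∈ C, inner ℝ v (w - y) ≤ c * ‖w - y‖ ^ 2) :
    gradient h y + v ∈ frechetSubdifferential (constrained h C) y := by
  refine ⟨by simp [dom, constrained_of_mem hy], ?_⟩
  refine EReal.ge_of_forall_gt_iff_ge.1 fun z hz => ?_
  have hz' : z < 0 := by exact_mod_cast hz
  refine le_liminf_of_le (by isBoundedDefault) ?_
  have h1 := (hasGradientAt_iff_isLittleO.1 hd.hasGradientAt).bound
    (show 0 < -z / 2 by linarith)
  have h2 : ∀ᶠ w in 𝓝 y, |c| * ‖w - y‖ < -z / 2 := by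
    have : Tendsto (fun w => |c| * ‖w - y‖) (𝓝 y) (𝓝 (|c| * ‖y - y‖)) :=
      (Continuous.tendsto (by fun_prop) y)
    exact this.eventually_lt_const (by simp; linarith)
  filter_upwards [h1.filter_mono nhdsWithin_le_nhds, h2.filter_mono nhdsWithin_le_nhds,
    self_mem_nhdsWithin] with w hw1 hw2 hwy
  have hpos : 0 < ‖w - y‖ := norm_pos_iff.2 (sub_ne_zero.2 hwy)
  rw [constrained_of_mem hy]
  by_cases hw : w ∈ C
  · rw [constrained_of_mem hw]
    norm_cast
    rw [← EReal.coe_div]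
    norm_cast
    rw [le_div_iff₀ hpos, inner_add_left]
    have h3 := neg_le_of_abs_le hw1
    have h4 := hv w hw
    have h5 : c * ‖w - y‖ ^ 2 ≤ -z / 2 * ‖w - y‖ := by
      nlinarith [le_abs_self c, mul_le_mul_of_nonneg_right hw2.le hpos.le, sq_nonneg ‖w - y‖]
    linarith
  · rw [constrained_of_notMem hw, EReal.top_sub_coe, EReal.top_sub_coe,
      EReal.top_div_of_pos_ne_top (by exact_mod_cast hpos) (EReal.coe_ne_top _)]
    exact le_top

theorem frechetSubdifferential_subset_limitingSubdifferential (f : E → EReal) (x : E) :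
    frechetSubdifferential f x ⊆ limitingSubdifferential f x := fun p hp =>
  ⟨hp.1, fun _ => x, fun _ => p, tendsto_const_nhds, tendsto_const_nhds,
    fun _ => tendsto_const_nhds, fun _ => hp⟩

end Subgradients

/-! ### Desingularizing functions and the trapping argument -/

section KL

theorem IsDesingularizing.mul_deriv_le_sub {η : EReal} {φ : ℝ → ℝ} (hφ : IsDesingularizing η φ)
    {s t : ℝ} (hs : 0 ≤ s) (hst : s ≤ t) (ht : 0 < t) (htη : (t : EReal) < η) :
    (t - s) * deriv φ t ≤ φ t - φ s := by
  rcases hst.eq_or_lt with rfl | hlt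
  · simp
  have hd : DifferentiableAt ℝ φ t :=
    differentiableAt_of_deriv_ne_zero (hφ.deriv_pos t ht htη).ne'
  have := hφ.concaveOn.deriv_le_slope
    ⟨hs, lt_of_le_of_lt (by exact_mod_cast hst) htη⟩ ⟨ht.le, htη⟩ hlt hd
  rw [slope_def_field, le_div_iff₀ (sub_pos.2 hlt)] at this
  linarith

/-- The KL inequality in real form: any bound `B` on the norm of one limiting subgradient can
replace the lazy slope. -/
theorem HasKLPropertyAt.one_le_deriv_mul {E : Type*} [NormedAddCommGroup E]
    [InnerProductSpace ℝ E] {f : E → EReal} {η : EReal} {φ : ℝ → ℝ} {x₀ x p : E} {δ a b B : ℝ}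
    (hφ : IsDesingularizing η φ)
    (hKL : ∀ x ∈ strictUpperLevel f η x₀ δ,
      1 ≤ ENNReal.ofReal (deriv φ (f x - f x₀).toReal) * lazySlope f x)
    (ha : f x₀ = a) (hb : f x = b) (hx : ‖x - x₀‖ < δ) (hab : a < b)
    (hη : ((b - a : ℝ) : EReal) < η) (hp : p ∈ limitingSubdifferential f x) (hpB : ‖p‖ ≤ B) :
    1 ≤ deriv φ (b - a) * B := by
  have hmem : x ∈ strictUpperLevel f η x₀ δ := by
    refine ⟨hx, by rw [ha, hb]; exact_mod_cast hab, ?_⟩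
    rw [ha, hb]
    have := EReal.add_lt_add_left_coe hη a
    rw [← EReal.coe_add] at this
    simpa using this
  have h1 := hKL x hmem
  have h2 : lazySlope f x ≤ ENNReal.ofReal B :=
    (iInf₂_le p hp).trans (ENNReal.ofReal_le_ofReal hpB)
  have h3 : (f x - f x₀).toReal = b - a := by
    rw [ha, hb, ← EReal.coe_sub, EReal.toReal_coe]
  rw [h3] at h1
  have h4 := h1.trans (mul_le_mul_right h2 _)
  rwa [← ENNReal.ofReal_mul (hφ.deriv_pos _ (sub_pos.2 hab) hη).le, ENNReal.one_le_ofReal] at h4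

/-- If `ψ ≥ 0` decreases by at least the length of each step that starts in the ball of radius `δ`
about `x₀`, and `dist (x K) x₀ + ψ K < δ`, then the sequence stays in the ball from `K` on, because
`dist (x k) x₀ + ψ k` does not increase; its length is then at most `ψ K` beyond `K`. -/
theorem summable_dist_of_local_lyapunov {X : Type*} [PseudoMetricSpace X] {x : ℕ → X} {x₀ : X}
    {ψ : ℕ → ℝ} {δ : ℝ} {K : ℕ} (hψ : ∀ k, K ≤ k → 0 ≤ ψ k)
    (hstep : ∀ k, K ≤ k → dist (x k) x₀ < δ → dist (x k) (x (k + 1)) + ψ (k + 1) ≤ ψ k)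
    (hK : dist (x K) x₀ + ψ K < δ) : Summable fun k => dist (x k) (x (k + 1)) := by
  have htrap : ∀ n, dist (x (K + n)) x₀ + ψ (K + n) < δ := by
    intro n
    induction n with
    | zero => exact hK
    | succ n ih =>
      have h0 := hψ (K + n) (Nat.le_add_right _ _)
      have h1 := hstep (K + n) (Nat.le_add_right _ _) (by linarith)
      have h2 := dist_triangle_left (x (K + n + 1)) x₀ (x (K + n))
      rw [← add_assoc]
      linarith
  have hsum : ∀ n, ∑ i ∈ Finset.range n, dist (x (K + i)) (x (K + i + 1)) + ψ (K + n) ≤ ψ K := by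
    intro n
    induction n with
    | zero => simp
    | succ n ih =>
      have h0 := hψ (K + n) (Nat.le_add_right _ _)
      have h1 := hstep (K + n) (Nat.le_add_right _ _) (by linarith [htrap n])
      rw [Finset.sum_range_succ, ← add_assoc]
      linarith
  rw [← summable_nat_add_iff K]
  refine summable_of_sum_range_le (c := ψ K) (fun _ => dist_nonneg) fun n => ?_
  have := hsum n
  simp only [add_comm _ K]
  linarith [hψ (K + n) (Nat.le_add_right _ _)]

theorem frequently_lt_mul_of_not_summable {d l : ℕ → ℝ} (hd : Summable d) (hl : ∀ k, 0 ≤ l k)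
    (hl' : ¬ Summable l) {e : ℝ} (he : 0 < e) : ∃ᶠ k in atTop, d k < e * l k := by
  intro hcon
  obtain ⟨n, hn⟩ := eventually_atTop.1 hcon
  refine hl' ((summable_nat_add_iff n).1 (Summable.of_nonneg_of_le (fun k => hl _)
    (fun k => ?_) (((summable_nat_add_iff n).2 hd).mul_left e⁻¹)))
  have := not_lt.1 (hn (k + n) (Nat.le_add_left _ _))
  rwa [inv_mul_eq_div, le_div_iff₀' he]

end KL

/-! ### Convergence of abstract descent sequences under the KL inequality -/

section FiniteLength

variable {E : Type*} [NormedAddCommGroup E] [InnerProductSpace ℝ E]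

theorem IsDesingularizing.tendsto_comp_zero {η : EReal} {φ : ℝ → ℝ}
    (hφ : IsDesingularizing η φ) {r : ℕ → ℝ} (hr : Tendsto r atTop (𝓝 0)) (hr0 : ∀ k, 0 ≤ r k) :
    (∀ᶠ k in atTop, (r k : EReal) < η) ∧ Tendsto (fun k => φ (r k)) atTop (𝓝 0) := by
  have hη : ∀ᶠ k in atTop, (r k : EReal) < η :=
    ((continuous_coe_real_ereal.tendsto 0).comp hr).eventually_lt_const (by simpa using hφ.pos)
  refine ⟨hη, ?_⟩
  have h0 := hφ.continuousOn 0 ⟨le_rfl, by simpa using hφ.pos⟩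
  have h1 : Tendsto r atTop (𝓝[{t : ℝ | 0 ≤ t ∧ (t : EReal) < η}] 0) :=
    tendsto_nhdsWithin_iff.2 ⟨hr, hη.mono fun k hk => ⟨hr0 k, hk⟩⟩
  simpa [Function.comp_def, hφ.map_zero] using h0.tendsto.comp h1

/-- The one-step estimate. Here `d`, `l` and `d'`, `l'` are the lengths and step sizes of two
consecutive steps, and the second one decreases the gap to the limit value from `t` to `s`. -/
theorem two_mul_dist_le_of_KL {η : EReal} {φ : ℝ → ℝ} {c R K d d' l l' s t : ℝ}
    (hφ : IsDesingularizing η φ) (hc : 0 < c) (hl : 0 < l) (hl' : 0 < l') (hR : l' ≤ R * l)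
    (hK : 0 ≤ K) (hd : 0 ≤ d) (hs : 0 ≤ s) (hst : s ≤ t) (ht : 0 < t) (htη : (t : EReal) < η)
    (hdesc : c * d' ^ 2 ≤ l' * (t - s)) (hKL : 1 ≤ deriv φ t * (K * d / l)) :
    2 * d' ≤ d + R * K / c * (φ t - φ s) := by
  have hφ1 := hφ.mul_deriv_le_sub hs hst ht htη
  have hD : 0 ≤ φ t - φ s :=
    le_trans (mul_nonneg (sub_nonneg.2 hst) (hφ.deriv_pos t ht htη).le) hφ1
  have hR0 : 0 ≤ R := nonneg_of_mul_nonneg_left (hl'.le.trans hR) hl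
  have h1 : t - s ≤ (φ t - φ s) * (K * d / l) := calc
    t - s ≤ (t - s) * (deriv φ t * (K * d / l)) := le_mul_of_one_le_right (sub_nonneg.2 hst) hKL
    _ = (t - s) * deriv φ t * (K * d / l) := by ring
    _ ≤ _ := mul_le_mul_of_nonneg_right hφ1 (by positivity)
  have h2 : c * d' ^ 2 ≤ R * K * d * (φ t - φ s) := calc
    c * d' ^ 2 ≤ l' * (t - s) := hdesc
    _ ≤ l' * ((φ t - φ s) * (K * d / l)) := mul_le_mul_of_nonneg_left h1 hl'.le
    _ ≤ R * l * ((φ t - φ s) * (K * d / l)) := mul_le_mul_of_nonneg_right hR (by positivity)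
    _ = R * K * d * (φ t - φ s) := by field_simp
  have h3 : d' ^ 2 ≤ d * (R * K / c * (φ t - φ s)) := by
    rw [← mul_le_mul_iff_right₀ hc]
    calc c * d' ^ 2 ≤ _ := h2
      _ = _ := by field_simp
  have h4 : 0 ≤ R * K / c * (φ t - φ s) := by positivity
  refine le_of_abs_le (abs_le_of_sq_le_sq' ?_ (by positivity) |> abs_le.2)
  nlinarith [sq_nonneg (d - R * K / c * (φ t - φ s))]

/-- A bounded sequence in `C` with sufficient decrease `hdesc` and subgradients `p k` controlled by
`hpK` has finite length and converges to a critical point, for step sizes `l` which may tend to `0`,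
but not summably. -/
theorem summable_and_exists_isCriticalPoint [FiniteDimensional ℝ E] {h : E → ℝ} {C : Set E}
    (hh : Continuous h) (hC : IsClosed C)
    (hKL : ∀ y ∈ C, HasKLPropertyAt (constrained h C) y)
    {l : ℕ → ℝ} {lb c R K : ℝ} (hl : ∀ k, 0 < l k) (hlb : ∀ k, l k ≤ lb) (hl' : ¬ Summable l)
    (hR : ∀ k, l (k + 1) ≤ R * l k) (hc : 0 < c) (hK : 0 ≤ K)
    {x p : ℕ → E} (hxC : ∀ k, x k ∈ C) (hxb : Bornology.IsBounded (Set.range x))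
    (hdesc : ∀ k, c * dist (x k) (x (k + 1)) ^ 2 ≤ l k * (h (x k) - h (x (k + 1))))
    (hp : ∀ k, p k ∈ frechetSubdifferential (constrained h C) (x (k + 1)))
    (hpK : ∀ k, l k * ‖p k‖ ≤ K * dist (x k) (x (k + 1))) :
    Summable (fun k => dist (x k) (x (k + 1))) ∧
      ∃ y, Tendsto x atTop (𝓝 y) ∧ IsCriticalPoint (constrained h C) y := by
  have : ProperSpace E := FiniteDimensional.proper ℝ E
  obtain ⟨y, -, σ, hσ, hσy⟩ := tendsto_subseq_of_bounded hxb fun k => Set.mem_range_self k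
  have hyC : y ∈ C := hC.mem_of_tendsto hσy (Eventually.of_forall fun k => hxC _)
  have hanti : Antitone fun k => h (x k) - h y := antitone_nat_of_succ_le fun k => by
    have := nonneg_of_mul_nonneg_right ((by positivity :
      (0 : ℝ) ≤ c * dist (x k) (x (k + 1)) ^ 2).trans (hdesc k)) (hl k)
    linarith
  have hr : Tendsto (fun k => h (x k) - h y) atTop (𝓝 0) := by
    refine (tendsto_iff_tendsto_subseq_of_antitone hanti hσ.tendsto_atTop).2 ?_
    simpa [Function.comp_def] using ((hh.tendsto y).comp hσy).sub_const (h y)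
  have hr0 : ∀ k, 0 ≤ h (x k) - h y := fun k => hanti.le_of_tendsto hr k
  have hΔ : Tendsto (fun k => dist (x k) (x (k + 1))) atTop (𝓝 0) := by
    have h1 : Tendsto (fun k => lb / c * ((h (x k) - h y) - (h (x (k + 1)) - h y)))
        atTop (𝓝 0) := by
      simpa using (hr.sub (hr.comp (tendsto_add_atTop_nat 1))).const_mul (lb / c)
    have h2 : Tendsto (fun k => dist (x k) (x (k + 1)) ^ 2) atTop (𝓝 0) := by
      refine squeeze_zero (fun k => by positivity) (fun k => ?_) h1
      rw [← mul_le_mul_iff_right₀ hc]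
      calc _ ≤ l k * (h (x k) - h (x (k + 1))) := hdesc k
        _ ≤ lb * (h (x k) - h (x (k + 1))) :=
          mul_le_mul_of_nonneg_right (hlb k) (by linarith [hanti k.le_succ])
        _ = _ := by field_simp; ring
    simpa [Real.sqrt_sq dist_nonneg] using h2.sqrt
  have hsum : Summable fun k => dist (x k) (x (k + 1)) := by
    -- The KL inequality says nothing at the limit value, where the sequence is stationary.
    by_cases hfin : ∃ n, h (x n) - h y = 0
    · obtain ⟨n, hn⟩ := hfin
      have hz : ∀ k, h (x (k + n)) - h y = 0 := fun k =>
        le_antisymm (hn ▸ hanti (Nat.le_add_left n k)) (hr0 _)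
      rw [← summable_nat_add_iff n]
      convert summable_zero with k
      have h1 := hdesc (k + n)
      have h2 := hz (k + 1)
      rw [add_right_comm] at h2
      rw [show h (x (k + n)) - h (x (k + n + 1)) = 0 by linarith [hz k], mul_zero] at h1
      exact pow_eq_zero_iff two_ne_zero |>.1
        (le_antisymm (nonpos_of_mul_nonpos_right h1 hc) (sq_nonneg _))
    · have hrpos : ∀ k, 0 < h (x k) - h y := fun k =>
        (hr0 k).lt_of_ne fun h0 => hfin ⟨k, h0.symm⟩
      obtain ⟨η, φ, δ, hφ, hδ, hineq⟩ := hKL y hyC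
      obtain ⟨hη, hφr⟩ := hφ.tendsto_comp_zero hr hr0
      obtain ⟨n, hn⟩ := eventually_atTop.1 hη
      have hR0 : 0 ≤ R := nonneg_of_mul_nonneg_left ((hl 1).le.trans (hR 0)) (hl 0)
      set ψ : ℕ → ℝ := fun k => dist (x (k - 1)) (x k) + R * K / c * φ (h (x k) - h y) with hψ
      have hψ0 : ∀ k, n ≤ k → 0 ≤ ψ k := fun k hk => by
        have := hφ.nonneg _ (hr0 k) (hn k hk)
        positivity
      have hstep : ∀ k, n + 1 ≤ k → dist (x k) y < δ →
          dist (x k) (x (k + 1)) + ψ (k + 1) ≤ ψ k := by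
        intro k hk hky
        obtain ⟨j, rfl⟩ : ∃ j, k = j + 1 := ⟨k - 1, by omega⟩
        have hkl := HasKLPropertyAt.one_le_deriv_mul hφ hineq (constrained_of_mem hyC)
          (constrained_of_mem (hxC (j + 1))) (by rwa [← dist_eq_norm])
          (sub_pos.1 (hrpos (j + 1))) (hn _ (by omega))
          (frechetSubdifferential_subset_limitingSubdifferential _ _ (hp j))
          ((le_div_iff₀' (hl j)).2 (hpK j))
        have := two_mul_dist_le_of_KL hφ hc (hl j) (hl (j + 1)) (hR j) hK dist_nonneg
          (hr0 (j + 1 + 1)) (hanti (j + 1).le_succ) (hrpos (j + 1)) (hn _ (by omega))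
          ((hdesc (j + 1)).trans_eq (by ring)) hkl
        simp only [hψ, Nat.add_sub_cancel]
        linarith
      have hψt : Tendsto ψ atTop (𝓝 0) := by
        have h1 : Tendsto (fun k => dist (x (k - 1)) (x k)) atTop (𝓝 0) :=
          (tendsto_add_atTop_iff_nat 1).1 (by simpa using hΔ)
        simpa using h1.add (hφr.const_mul (R * K / c))
      have hlim : Tendsto (fun i => dist (x (σ i)) y + ψ (σ i)) atTop (𝓝 0) := by
        simpa using (tendsto_iff_dist_tendsto_zero.1 hσy).add (hψt.comp hσ.tendsto_atTop)
      obtain ⟨i, hi, hi'⟩ := ((hlim.eventually_lt_const hδ).and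
        (hσ.tendsto_atTop.eventually_ge_atTop (n + 1))).exists
      exact summable_dist_of_local_lyapunov (fun k hk => hψ0 k (by omega))
        (fun k hk => hstep k (hi'.trans hk)) hi
  have hxy : Tendsto x atTop (𝓝 y) :=
    tendsto_nhds_of_cauchySeq_of_subseq (cauchySeq_of_summable_dist hsum) hσ.tendsto_atTop hσy
  refine ⟨hsum, y, hxy, ?_⟩
  -- Along `τ`, the step lengths are negligible compared with the step sizes.
  obtain ⟨τ, hτ, hτl⟩ := extraction_forall_of_frequently fun m : ℕ =>
    frequently_lt_mul_of_not_summable hsum (fun k => (hl k).le) hl'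
      (Nat.one_div_pos_of_nat (α := ℝ) (n := m))
  have hτx : Tendsto (fun m => x (τ m + 1)) atTop (𝓝 y) :=
    ((tendsto_add_atTop_iff_nat 1).2 hxy).comp hτ.tendsto_atTop
  have hq : Tendsto (fun m => p (τ m)) atTop (𝓝 0) := by
    refine squeeze_zero_norm (a := fun m : ℕ => K * (1 / ((m : ℝ) + 1))) (fun m => ?_) ?_
    · rw [← mul_le_mul_iff_right₀ (hl (τ m))]
      calc _ ≤ _ := hpK (τ m)
        _ ≤ _ := mul_le_mul_of_nonneg_left (hτl m).le hK
        _ = _ := by ring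
    · simpa using tendsto_one_div_add_atTop_nhds_zero_nat.const_mul K
  refine ⟨by simp [dom, constrained_of_mem hyC], fun m => x (τ m + 1), fun m => p (τ m), hτx, ?_,
    fun v => hq.inner tendsto_const_nhds, fun m => hp (τ m)⟩
  simp only [constrained_of_mem (hxC _), constrained_of_mem hyC]
  exact (continuous_coe_real_ereal.tendsto _).comp ((hh.tendsto y).comp hτx)

end FiniteLength

/-! ### Bounds on Levenberg-Marquardt metrics, and metric projections -/

section Metric

variable {N : ℕ}

open Matrix

theorem abs_apply_le_of_mem_clarkeHessian {h : EuclideanSpace ℝ (Fin N) → ℝ} {L : NNReal}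
    (hL : LipschitzWith L (gradient h)) {x : EuclideanSpace ℝ (Fin N)}
    {M : Matrix (Fin N) (Fin N) ℝ} (hM : M ∈ clarkeHessian h x) (i j : Fin N) :
    |M i j| ≤ L := by
  have hconv : Convex ℝ {M : Matrix (Fin N) (Fin N) ℝ | |M i j| ≤ L} := by
    intro P hP Q hQ a b ha hb hab
    simp only [Set.mem_ofPred_eq, Matrix.add_apply, Matrix.smul_apply, smul_eq_mul] at *
    have h1 := abs_add_le (a * P i j) (b * Q i j)
    rw [abs_mul, abs_mul, abs_of_nonneg ha, abs_of_nonneg hb] at h1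
    have : (L : ℝ) = a * L + b * L := by rw [← add_mul, hab, one_mul]
    nlinarith
  refine convexHull_min ?_ hconv hM
  rintro P ⟨u, -, -, hP⟩
  have hPij : Tendsto (fun n => |hessianMatrix h (u n) i j|) atTop (𝓝 |P i j|) :=
    ((tendsto_pi_nhds.1 (tendsto_pi_nhds.1 hP i)) j).abs
  refine le_of_tendsto' hPij fun n => ?_
  calc |hessianMatrix h (u n) i j|
      ≤ ‖fderiv ℝ (gradient h) (u n) (EuclideanSpace.single j (1 : ℝ))‖ := by
        simpa [hessianMatrix] using
          PiLp.norm_apply_le (fderiv ℝ (gradient h) (u n) (EuclideanSpace.single j (1 : ℝ))) i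
    _ ≤ ‖fderiv ℝ (gradient h) (u n)‖ * ‖EuclideanSpace.single j (1 : ℝ)‖ :=
        ContinuousLinearMap.le_opNorm _ _
    _ ≤ L := by simpa using norm_fderiv_le_of_lipschitz ℝ hL

theorem abs_apply_le_frobeniusNorm (M : Matrix (Fin N) (Fin N) ℝ) (i j : Fin N) :
    |M i j| ≤ frobeniusNorm M := by
  refine Real.abs_le_sqrt ?_
  calc M i j ^ 2 ≤ ∑ j, M i j ^ 2 :=
        Finset.single_le_sum (f := fun j => M i j ^ 2) (fun _ _ => sq_nonneg _)
          (Finset.mem_univ j)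
    _ ≤ ∑ i, ∑ j, M i j ^ 2 :=
        Finset.single_le_sum (f := fun i => ∑ j, M i j ^ 2)
          (fun _ _ => Finset.sum_nonneg fun _ _ => sq_nonneg _) (Finset.mem_univ i)

theorem frobeniusNorm_le {M : Matrix (Fin N) (Fin N) ℝ} {b : ℝ} (hb : 0 ≤ b)
    (hM : ∀ i j, |M i j| ≤ b) : frobeniusNorm M ≤ N * b := by
  refine Real.sqrt_le_iff.2 ⟨by positivity, ?_⟩
  calc ∑ i, ∑ j, M i j ^ 2 ≤ ∑ _i : Fin N, ∑ _j : Fin N, b ^ 2 :=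
        Finset.sum_le_sum fun i _ => Finset.sum_le_sum fun j _ => sq_le_sq'
          (neg_le_of_abs_le (hM i j)) (le_of_abs_le (hM i j))
    _ = (N * b) ^ 2 := by simp; ring

/-- Since `0` is positive semidefinite, `M - P` is no larger than `M` in Frobenius norm. -/
theorem IsPSDProjection.abs_apply_le {M P : Matrix (Fin N) (Fin N) ℝ}
    (hP : IsPSDProjection M P) {b : ℝ} (hb : 0 ≤ b) (hM : ∀ i j, |M i j| ≤ b) (i j : Fin N) :
    |P i j| ≤ b + N * b := by
  have h1 := hP.2 0 Matrix.PosSemidef.zero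
  rw [sub_zero] at h1
  have h2 := (abs_apply_le_frobeniusNorm (M - P) i j).trans (h1.trans (frobeniusNorm_le hb hM))
  rw [Matrix.sub_apply, abs_sub_comm] at h2
  linarith [abs_sub_abs_le_abs_sub (P i j) (M i j), hM i j]

theorem norm_toEuclideanCLM_le {A : Matrix (Fin N) (Fin N) ℝ} {b : ℝ} (hb : 0 ≤ b)
    (hA : ∀ i j, |A i j| ≤ b) : ‖toEuclideanCLM (𝕜 := ℝ) A‖ ≤ N * b * N := by
  refine ContinuousLinearMap.opNorm_le_bound _ (by positivity) fun v => ?_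
  have hent : ∀ i, |toEuclideanCLM (𝕜 := ℝ) A v i| ≤ N * b * ‖v‖ := by
    intro i
    have h1 : toEuclideanCLM (𝕜 := ℝ) A v i = ∑ j, A i j * v j := by
      rw [ofLp_toEuclideanCLM]; rfl
    rw [h1]
    calc |∑ j, A i j * v j| ≤ ∑ j, |A i j * v j| := Finset.abs_sum_le_sum_abs _ _
      _ ≤ ∑ _j : Fin N, b * ‖v‖ := Finset.sum_le_sum fun j _ => by
          rw [abs_mul]
          exact mul_le_mul (hA i j) (PiLp.norm_apply_le v j) (abs_nonneg _) hb
      _ = N * b * ‖v‖ := by simp; ring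
  set w := toEuclideanCLM (𝕜 := ℝ) A v
  calc ‖w‖ = ‖∑ i, w i • EuclideanSpace.basisFun (Fin N) ℝ i‖ := by
        conv_lhs => rw [← (EuclideanSpace.basisFun (Fin N) ℝ).sum_repr w]
        simp
    _ ≤ ∑ i, ‖w i • EuclideanSpace.basisFun (Fin N) ℝ i‖ := norm_sum_le _ _
    _ ≤ ∑ _i : Fin N, N * b * ‖v‖ := Finset.sum_le_sum fun i _ => by
        simpa [norm_smul] using hent i
    _ = N * b * N * ‖v‖ := by simp; ring

theorem IsLevenbergMarquardtMetric.posDef {h : EuclideanSpace ℝ (Fin N) → ℝ} {ε : ℝ}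
    (hε : 0 < ε) {x : EuclideanSpace ℝ (Fin N)} {A : Matrix (Fin N) (Fin N) ℝ}
    (hA : IsLevenbergMarquardtMetric h ε x A) : A.PosDef := by
  obtain ⟨M, -, P, hP, rfl⟩ := hA
  exact Matrix.PosDef.posSemidef_add hP.1 (Matrix.PosDef.one.smul hε)

theorem IsLevenbergMarquardtMetric.mul_norm_sq_le {h : EuclideanSpace ℝ (Fin N) → ℝ} {ε : ℝ}
    {x : EuclideanSpace ℝ (Fin N)} {A : Matrix (Fin N) (Fin N) ℝ}
    (hA : IsLevenbergMarquardtMetric h ε x A) (v : EuclideanSpace ℝ (Fin N)) :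
    ε * ‖v‖ ^ 2 ≤ inner ℝ (toEuclideanCLM (𝕜 := ℝ) A v) v := by
  obtain ⟨M, -, P, hP, rfl⟩ := hA
  have h1 : 0 ≤ (inner ℝ v (toEuclideanCLM (𝕜 := ℝ) P v) : ℝ) := by
    rw [inner_toEuclideanCLM]
    simpa using hP.1.dotProduct_mulVec_nonneg v
  rw [real_inner_comm, map_add, map_smul, map_one, _root_.add_apply,
    _root_.smul_apply, one_apply_eq_self, inner_add_right,
    inner_smul_right, real_inner_self_eq_norm_sq]
  linarith

theorem exists_norm_toEuclideanCLM_le {h : EuclideanSpace ℝ (Fin N) → ℝ} {L : NNReal}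
    (hL : LipschitzWith L (gradient h)) {ε : ℝ} (hε : 0 ≤ ε) :
    ∃ K, 0 ≤ K ∧ ∀ x A, IsLevenbergMarquardtMetric h ε x A →
      ‖toEuclideanCLM (𝕜 := ℝ) A‖ ≤ K := by
  refine ⟨N * (L + N * L + ε) * N, by positivity, ?_⟩
  rintro x A ⟨M, hM, P, hP, rfl⟩
  refine norm_toEuclideanCLM_le (by positivity) fun i j => ?_
  have h1 := hP.abs_apply_le L.coe_nonneg (abs_apply_le_of_mem_clarkeHessian hL hM) i j
  have h2 : |(ε • (1 : Matrix (Fin N) (Fin N) ℝ)) i j| ≤ ε := by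
    by_cases hij : i = j
    · simp [hij, abs_of_nonneg hε]
    · simp [Matrix.one_apply_ne hij, hε]
  exact (abs_add_le _ _).trans (add_le_add h1 h2)

theorem inner_toEuclideanCLM_left {A : Matrix (Fin N) (Fin N) ℝ} (hA : A.IsHermitian)
    (u v : EuclideanSpace ℝ (Fin N)) :
    inner ℝ (toEuclideanCLM (𝕜 := ℝ) A u) v = inner ℝ u (toEuclideanCLM (𝕜 := ℝ) A v) := by
  rw [← ContinuousLinearMap.adjoint_inner_right, ← ContinuousLinearMap.star_eq_adjoint,
    ← map_star, Matrix.star_eq_conjTranspose, hA.eq]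

/-- Up to a constant independent of `w`, the squared distance from `w` to `x - l A⁻¹ g` in the metric
`A` is the quadratic function `⟪A (w - x), w - x⟫ + 2 l ⟪g, w - x⟫`, which a projection therefore
minimizes over `C`. -/
theorem inner_add_inner_le_of_mem_metricProj {C : Set (EuclideanSpace ℝ (Fin N))}
    {A : Matrix (Fin N) (Fin N) ℝ} (hA : A.PosDef) {l : ℝ} {x g y w : EuclideanSpace ℝ (Fin N)}
    (hy : y ∈ metricProj C A (x - l • toEuclideanCLM (𝕜 := ℝ) A⁻¹ g)) (hw : w ∈ C) :
    inner ℝ (toEuclideanCLM (𝕜 := ℝ) A (y - x)) (y - x) + 2 * l * inner ℝ g (y - x) ≤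
      inner ℝ (toEuclideanCLM (𝕜 := ℝ) A (w - x)) (w - x) + 2 * l * inner ℝ g (w - x) := by
  set T := toEuclideanCLM (𝕜 := ℝ) A with hT
  set s := toEuclideanCLM (𝕜 := ℝ) A⁻¹ g with hs
  have hTs : T s = g := by
    rw [hT, hs, ← mul_apply_eq_comp, ← map_mul,
      Matrix.mul_nonsing_inv _ ((Matrix.isUnit_iff_isUnit_det _).1 hA.isUnit), map_one,
      one_apply_eq_self]
  have hexp : ∀ z, (inner ℝ (T (z - (x - l • s))) (z - (x - l • s)) : ℝ) =
      inner ℝ (T (z - x)) (z - x) + 2 * l * inner ℝ g (z - x) + l ^ 2 * inner ℝ g s := by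
    intro z
    have h1 : inner ℝ (T (z - x)) s = (inner ℝ g (z - x) : ℝ) := by
      rw [inner_toEuclideanCLM_left hA.1, ← hT, hTs, real_inner_comm]
    rw [show z - (x - l • s) = (z - x) + l • s by abel, map_add, map_smul, hTs,
      inner_add_left, inner_add_right, inner_add_right, inner_smul_left, inner_smul_right,
      inner_smul_left, inner_smul_right, h1]
    simp only [conj_trivial]
    ring
  have hpos : 0 ≤ (inner ℝ (T (w - (x - l • s))) (w - (x - l • s)) : ℝ) := by
    rw [real_inner_comm, inner_toEuclideanCLM]
    simpa using hA.posSemidef.dotProduct_mulVec_nonneg (w - (x - l • s))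
  have h2 := (Real.sqrt_le_sqrt_iff hpos).1 (hy.2 w hw)
  rw [← hT, hexp, hexp] at h2
  linarith

end Metric

/-! ### Decrease and subgradient bound for one step of the method -/

section Step

variable {N : ℕ} {h : EuclideanSpace ℝ (Fin N) → ℝ} {C : Set (EuclideanSpace ℝ (Fin N))}
  {L : NNReal} {ε l : ℝ} {A : Matrix (Fin N) (Fin N) ℝ} {x y : EuclideanSpace ℝ (Fin N)}

open Matrix

theorem sufficient_decrease (hd : Differentiable ℝ h) (hL : LipschitzWith L (gradient h))
    (hε : 0 < ε) (hA : IsLevenbergMarquardtMetric h ε x A) (hl : 0 < l) (hx : x ∈ C)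
    (hy : y ∈ metricProj C A (x - l • toEuclideanCLM (𝕜 := ℝ) A⁻¹ (gradient h x))) :
    (ε - l * L) / 2 * dist x y ^ 2 ≤ l * (h x - h y) := by
  have h1 := inner_add_inner_le_of_mem_metricProj (hA.posDef hε) hy hx
  have h2 := hA.mul_norm_sq_le (y - x)
  have h3 := mul_le_mul_of_nonneg_left (le_add_inner_gradient_add_sq hd hL x y) hl.le
  simp only [sub_self, inner_zero_right, mul_zero, add_zero] at h1
  rw [dist_comm, dist_eq_norm]
  linarith

theorem exists_frechetSubgradient_norm_le (hd : Differentiable ℝ h)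
    (hL : LipschitzWith L (gradient h)) (hε : 0 < ε) (hA : IsLevenbergMarquardtMetric h ε x A)
    (hl : 0 < l) (hy : y ∈ metricProj C A (x - l • toEuclideanCLM (𝕜 := ℝ) A⁻¹ (gradient h x))) :
    ∃ p ∈ frechetSubdifferential (constrained h C) y,
      l * ‖p‖ ≤ (l * L + ‖toEuclideanCLM (𝕜 := ℝ) A‖) * dist x y := by
  set T := toEuclideanCLM (𝕜 := ℝ) A with hT
  refine ⟨gradient h y + (-gradient h x - l⁻¹ • T (y - x)),
    gradient_add_mem_frechetSubdifferential (hd y) hy.1 (‖T‖ / (2 * l)) fun w hw => ?_, ?_⟩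
  · have h1 := inner_add_inner_le_of_mem_metricProj (hA.posDef hε) hy hw
    rw [show w - x = (y - x) + (w - y) by abel, ← hT, map_add, inner_add_left, inner_add_right,
      inner_add_right, inner_add_right, inner_toEuclideanCLM_left (hA.posDef hε).1 (w - y) (y - x),
      ← hT, real_inner_comm _ (w - y)] at h1
    have h2 : inner ℝ (T (w - y)) (w - y) ≤ ‖T‖ * ‖w - y‖ ^ 2 := by
      refine (real_inner_le_norm _ _).trans ?_
      rw [pow_two, ← mul_assoc]
      exact mul_le_mul_of_nonneg_right (T.le_opNorm _) (norm_nonneg _)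
    rw [inner_sub_left, inner_neg_left, inner_smul_left, conj_trivial, div_mul_eq_mul_div,
      le_div_iff₀ (by positivity)]
    have h3 : (-inner ℝ (gradient h x) (w - y) - l⁻¹ * inner ℝ (T (y - x)) (w - y)) * (2 * l) =
        -(2 * l * inner ℝ (gradient h x) (w - y)) - 2 * inner ℝ (T (y - x)) (w - y) := by
      field_simp
    rw [h3]
    linarith
  · rw [show gradient h y + (-gradient h x - l⁻¹ • T (y - x)) =
      (gradient h y - gradient h x) - l⁻¹ • T (y - x) by abel, dist_comm, dist_eq_norm]
    have h1 := hL.norm_sub_le y x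
    have h2 := T.le_opNorm (y - x)
    calc l * ‖(gradient h y - gradient h x) - l⁻¹ • T (y - x)‖
        ≤ l * (‖gradient h y - gradient h x‖ + ‖l⁻¹ • T (y - x)‖) :=
          mul_le_mul_of_nonneg_left (norm_sub_le _ _) hl.le
      _ = l * ‖gradient h y - gradient h x‖ + ‖T (y - x)‖ := by
          rw [norm_smul, Real.norm_of_nonneg (inv_nonneg.2 hl.le), mul_add,
            mul_inv_cancel_left₀ hl.ne']
      _ ≤ l * (L * ‖y - x‖) + ‖T‖ * ‖y - x‖ :=
          add_le_add (mul_le_mul_of_nonneg_left h1 hl.le) h2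
      _ = _ := by ring

end Step

end GLM

theorem mainTheorem11 (N : ℕ)
    (h : EuclideanSpace ℝ (Fin N) → ℝ) (C : Set (EuclideanSpace ℝ (Fin N)))
    (hC_closed : IsClosed C) (hC_nonempty : C.Nonempty)
    (L : NNReal) (h_diff : Differentiable ℝ h) (h_lip : LipschitzWith L (gradient h))
    (hKL : GLM.IsKLFunction (GLM.constrained h C))
    (ε : ℝ) (hε : 0 < ε)
    (lam : ℕ → ℝ) (lamBar : ℝ)
    (hlam_pos : ∀ k, 0 < lam k) (hlam_le : ∀ k, lam k ≤ lamBar)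
    (hlamBar : lamBar * (L : ℝ) < ε)
    (hlam_not_summable : ¬ Summable lam)
    (hlam_ratio : BddAbove (Set.range fun k => lam (k + 1) / lam k))
    (x : ℕ → EuclideanSpace ℝ (Fin N)) (A : ℕ → Matrix (Fin N) (Fin N) ℝ)
    (hA : ∀ k, GLM.IsLevenbergMarquardtMetric h ε (x k) (A k))
    (hx : ∀ k, x (k + 1) ∈ GLM.metricProj C (A k)
      (x k - lam k • Matrix.toEuclideanCLM (𝕜 := ℝ) ((A k)⁻¹) (gradient h (x k))))
    (hx_bdd : Bornology.IsBounded (Set.range x)) :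
    Summable (fun k => ‖x (k + 1) - x k‖) ∧
      ∃ xs : EuclideanSpace ℝ (Fin N), Tendsto x atTop (𝓝 xs) ∧
        GLM.IsCriticalPoint (GLM.constrained h C) xs := by
  obtain ⟨K, hK, hAK⟩ := GLM.exists_norm_toEuclideanCLM_le h_lip hε.le
  obtain ⟨R, hR⟩ := hlam_ratio
  have hbar : 0 ≤ lamBar := (hlam_pos 0).le.trans (hlam_le 0)
  -- The starting point need not lie in `C`, so the analysis is run on `k ↦ x (k + 1)`.
  choose p hp hpK using fun k => GLM.exists_frechetSubgradient_norm_le h_diff h_lip hε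
    (hA (k + 1)) (hlam_pos (k + 1)) (hx (k + 1))
  obtain ⟨hsum, y, hy, hcrit⟩ := GLM.summable_and_exists_isCriticalPoint
    (x := fun k => x (k + 1)) (p := p) (l := fun k => lam (k + 1)) (R := R)
    (c := (ε - lamBar * L) / 2) (K := lamBar * L + K) h_diff.continuous hC_closed
    -- On `C`, the gradient of `h` is itself a subgradient, so the KL inequality is available
    -- at every point of `C`.
    (fun y hy => hKL.kl y ⟨gradient h y + 0,
      GLM.frechetSubdifferential_subset_limitingSubdifferential _ _
        (GLM.gradient_add_mem_frechetSubdifferential (h_diff y) hy 0 (by simp))⟩)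
    (fun k => hlam_pos _) (fun k => hlam_le _)
    (fun hs => hlam_not_summable ((summable_nat_add_iff 1).1 hs))
    (fun k => (div_le_iff₀ (hlam_pos _)).1 (hR ⟨k + 1, rfl⟩))
    (by linarith) (by positivity) (fun k => (hx k).1)
    (hx_bdd.subset (Set.range_comp_subset_range (· + 1) x))
    (fun k => (mul_le_mul_of_nonneg_right (by
        have := mul_le_mul_of_nonneg_right (hlam_le (k + 1)) L.coe_nonneg
        linarith) (sq_nonneg _)).trans
      (GLM.sufficient_decrease h_diff h_lip hε (hA (k + 1)) (hlam_pos _) (hx k).1 (hx (k + 1))))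
    hp
    (fun k => (hpK k).trans (mul_le_mul_of_nonneg_right
      (add_le_add (mul_le_mul_of_nonneg_right (hlam_le _) L.coe_nonneg) (hAK _ _ (hA _)))
      dist_nonneg))
  refine ⟨(summable_nat_add_iff 1).1 ?_, y, (tendsto_add_atTop_iff_nat 1).1 hy, hcrit⟩
  exact hsum.congr fun k => by rw [dist_comm, dist_eq_norm]
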